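/- Let $n\ge 2$ and $-1<a<1$, let $S^n$ be the unit sphere of $\mathbb R^{n+1}$ with its surface measure $d\xi$, and let $A=(0,\dots,0,a)\in\mathbb R^{n+1}$. For $\xi\in S^n$ put $$\gamma_a(\xi)=\{\eta\in S^n:\ \xi\cdot(\eta-A)=0\},$$ an $(n-1)$-dimensional Euclidean sphere, and let $$(F_af)(\xi)=\int_{\gamma_a(\xi)}f(\eta)\,d_{\gamma_a}\eta ,\qquad \xi\in S^n,$$ where $d_{\gamma_a}\eta$ is the surface area measure on $\gamma_a(\xi)$ and $f$ is a real- or complex-valued function on $S^n$. Then: (i) if $f\in C^\infty(S^n)$, then $F_af\in C^\infty(S^n)$; (ii) if $f\in C(S^n)$, then the integral $(F_af)(\xi)$ exists for every $\xi\in S^n$ and $F_af\in C(S^n)$, and $F_a$ is a bounded linear operator on $C(S^n)$ with the supremum norm; (iii) for every $1\le p\le\infty$ and every $f\in L^p(S^n)$, the integral $(F_af)(\xi)$ exists in the Lebesgue sense for almost all $\xi\in S^n$, the class of $F_af$ modulo equality almost everywhere depends only on that of $f$, and $F_a$ is a bounded linear operator on $L^p(S^n)$. -/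

import Mathlib

open MeasureTheory
open scoped Manifold ContDiff ENNReal

noncomputable section

namespace SphericalSlice

/-- The unit sphere `Sⁿ` of the Euclidean space `ℝⁿ⁺¹`. -/
abbrev Sn (n : ℕ) : Type := Metric.sphere (0 : EuclideanSpace ℝ (Fin (n + 1))) 1

/-- The surface measure of `Sⁿ`: the `n`-dimensional Hausdorff measure (with the normalization
that agrees with Lebesgue measure on `ℝⁿ`). -/
def surfaceMeasure (n : ℕ) : Measure (Sn n) := μHE[n]

/-- The point `A = (0, …, 0, a)` of `ℝⁿ⁺¹`. -/
def pointA (n : ℕ) (a : ℝ) : EuclideanSpace ℝ (Fin (n + 1)) :=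
  EuclideanSpace.single (Fin.last n) a

/-- The slice of `Sⁿ` by the hyperplane through `A = (0, …, 0, a)` with normal vector `ξ`. -/
def slice {n : ℕ} (a : ℝ) (ξ : Sn n) : Set (Sn n) :=
  {η | inner ℝ (ξ : EuclideanSpace ℝ (Fin (n + 1))) (η - pointA n a) = 0}

/-- The surface area measure of the slice, as a measure on `Sⁿ` that is carried by the slice:
the slice is an `(n - 1)`-dimensional sphere, and its area is the `(n - 1)`-dimensional Hausdorff
measure (with the normalization that agrees with Lebesgue measure on `ℝⁿ⁻¹`). -/
def sliceMeasure {n : ℕ} (a : ℝ) (ξ : Sn n) : Measure (Sn n) :=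
  (μHE[n - 1] : Measure (Sn n)).restrict (slice a ξ)

/-- The spherical slice transform: the integral of `f` over the slice with normal `ξ`, with
respect to surface area. -/
def sliceTransform {𝕜 : Type*} [RCLike 𝕜] {n : ℕ} (a : ℝ) (f : Sn n → 𝕜) (ξ : Sn n) : 𝕜 :=
  ∫ η, f η ∂(sliceMeasure a ξ)

end SphericalSlice

end

/-!
The slice with normal `ξ` is the round sphere with centre `⟪ξ, A⟫ ξ` and radius `√(1 - ⟪ξ, A⟫²)`
in a hyperplane orthogonal to `ξ`; since `|a| < 1`, the radius is bounded below. A similarity,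
built from a reflection that carries a fixed unit vector `e` to `ξ`, parametrizes it by the fixed
great sphere orthogonal to `e` (`map_coe_sliceMeasure`). With `e = -ξ₀` the similarity depends
smoothly on `ξ` near `ξ₀`, so the transform of the restriction of a `C^m` function of the ambient
space is `C^m`, by differentiation under the integral (`contMDiff_integral_sliceMeasure`). Smooth
functions on the sphere extend smoothly to the ambient space, and continuous ones continuously;
this gives the assertions on `C^∞` and on `C`, the bound in the latter case being the boundedness
of the areas of the slices.

For the Lebesgue spaces, the point is that the average of the slice measures over all normals is
dominated by the surface measure `σ` (`exists_lintegral_sliceMeasure_le`). This follows from an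
inequality of Eilenberg type (`lintegral_hausdorffMeasure_inter_le`): the normals whose slices
meet a set of diameter `δ` lie in a zone of the sphere of width `O(δ)`, because `‖η - A‖ ≥ 1 -
|a|`, and such a zone has measure `O(δ)` (`exists_euclideanHausdorffMeasure_sphere_slab_le`). The
domination makes the transform well defined on classes modulo null sets and bounded on `L¹`; with
the boundedness of the areas of the slices, Hölder's inequality gives all `L^p`
(`eLpNorm_integral_kernel_le`).
-/

section

open Filter Topology Metric Module ProbabilityTheory

/-! ### Hausdorff measure of the sections of a set -/

/-- A near-optimal cover by sets of small diameter, read off from the definition of the Hausdorff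
measure. -/
theorem exists_cover_tsum_ediam_le {X : Type*} [EMetricSpace X] [MeasurableSpace X] [BorelSpace X]
    {d : ℝ} {B : Set X} (hB : μH[d] B ≠ ⊤) {r ε : ℝ≥0∞} (hr : 0 < r) (hε : ε ≠ 0) :
    ∃ t : ℕ → Set X, B ⊆ ⋃ i, t i ∧ (∀ i, ediam (t i) ≤ r) ∧
      ∑' i, ⨆ _ : (t i).Nonempty, ediam (t i) ^ d ≤ μH[d] B + ε := by
  by_contra! h
  refine (ENNReal.lt_add_right hB hε).not_ge ?_
  conv_rhs => rw [Measure.hausdorffMeasure_apply]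
  refine le_iSup₂_of_le r hr ?_
  exact le_iInf fun t => le_iInf fun h1 => le_iInf fun h2 => (h t h1 h2).le

/-- An inequality of Eilenberg type. Suppose that, for every set `t`, the parameters `y` whose
section `Γ y` meets `t` form a set of `σ`-mass at most a constant times the diameter of `t`. Then
integrating the `d`-dimensional measures of the sections of `B` costs at most the `(d +
1)`-dimensional measure of `B`. Indeed a cover `t i` of `B` covers each section, and the integral
of its `d`-dimensional content over the sections is at most `C * ∑ diam (t i) ^ (d + 1)`; pass to
the limit by Fatou's lemma. No measurability of `y ↦ Γ y` is required. -/
theorem lintegral_hausdorffMeasure_inter_le {X Y : Type*} [EMetricSpace X] [MeasurableSpace X]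
    [BorelSpace X] [MeasurableSpace Y] (σ : Measure Y) (Γ : Y → Set X) {C : ℝ≥0∞} (hC0 : C ≠ 0)
    (hC : C ≠ ⊤)
    (hΓ : ∀ t : Set X, t.Nonempty → ∃ N, MeasurableSet N ∧ (∀ y, (Γ y ∩ t).Nonempty → y ∈ N) ∧
      σ N ≤ C * ediam t)
    {d : ℝ} (hd : 0 < d) (B : Set X) :
    ∫⁻ y, μH[d] (B ∩ Γ y) ∂σ ≤ C * μH[d + 1] B := by
  rcases eq_or_ne (μH[d + 1] B) ⊤ with hB | hB
  · simp [hB, hC0]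
  let r : ℕ → ℝ≥0∞ := fun k => ((k : ℝ≥0∞) + 1)⁻¹
  have hr0 : ∀ k, 0 < r k := fun k => by simp [r]
  have hr : Tendsto r atTop (𝓝 0) := by
    have := (tendsto_add_atTop_iff_nat 1).2 ENNReal.tendsto_inv_nat_nhds_zero
    simpa [r] using this
  choose t htB htr hts using fun k => exists_cover_tsum_ediam_le hB (hr0 k) (hr0 k).ne'
  have hN : ∀ k i, ∃ N, MeasurableSet N ∧ (∀ y, (Γ y ∩ t k i).Nonempty → y ∈ N) ∧
      σ N ≤ C * ediam (t k i) := by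
    intro k i
    rcases (t k i).eq_empty_or_nonempty with h | h
    · exact ⟨∅, .empty, by simp [h], by simp⟩
    · exact hΓ _ h
  choose N hNm hNt hNσ using hN
  let g : ℕ → Y → ℝ≥0∞ := fun k y => ∑' i, (N k i).indicator (fun _ => ediam (t k i) ^ d) y
  have hg : ∀ k, Measurable (g k) := fun k =>
    Measurable.tsum fun i => measurable_const.indicator (hNm k i)
  have hle : ∀ y, μH[d] (B ∩ Γ y) ≤ liminf (fun k => g k y) atTop := by
    intro y
    refine (Measure.hausdorffMeasure_le_liminf_tsum d (B ∩ Γ y) r hr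
      (fun k i => t k i ∩ Γ y) (.of_forall fun k i => ?_) (.of_forall fun k => ?_)).trans ?_
    · exact (ediam_mono Set.inter_subset_left).trans (htr k i)
    · rw [← Set.iUnion_inter]
      exact Set.inter_subset_inter_left _ (htB k)
    · refine liminf_le_liminf (.of_forall fun k => ENNReal.tsum_le_tsum fun i => ?_)
      rcases (t k i ∩ Γ y).eq_empty_or_nonempty with h | h
      · simp [h, ENNReal.zero_rpow_of_pos hd]
      · rw [Set.indicator_of_mem (hNt k i y (by rwa [Set.inter_comm]))]
        exact ENNReal.rpow_le_rpow (ediam_mono Set.inter_subset_left) hd.le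
  calc ∫⁻ y, μH[d] (B ∩ Γ y) ∂σ ≤ ∫⁻ y, liminf (fun k => g k y) atTop ∂σ := lintegral_mono hle
    _ ≤ liminf (fun k => ∫⁻ y, g k y ∂σ) atTop := lintegral_liminf_le hg
    _ ≤ liminf (fun k => C * (μH[d + 1] B + r k)) atTop := by
        refine liminf_le_liminf (.of_forall fun k => ?_)
        calc ∫⁻ y, g k y ∂σ = ∑' i, ediam (t k i) ^ d * σ (N k i) := by
              simp only [g]
              rw [lintegral_tsum fun i => (measurable_const.indicator (hNm k i)).aemeasurable]
              simp_rw [lintegral_indicator_const (hNm k _)]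
          _ ≤ ∑' i, C * ⨆ _ : (t k i).Nonempty, ediam (t k i) ^ (d + 1) := by
              refine ENNReal.tsum_le_tsum fun i => ?_
              rcases (t k i).eq_empty_or_nonempty with h | h
              · simp [h, ENNReal.zero_rpow_of_pos hd]
              · simp only [h, ciSup_pos]
                calc _ ≤ ediam (t k i) ^ d * (C * ediam (t k i)) := by gcongr; exact hNσ k i
                  _ = _ := by
                    rw [ENNReal.rpow_add_of_nonneg _ _ hd.le zero_le_one, ENNReal.rpow_one]; ring
          _ ≤ C * (μH[d + 1] B + r k) := by
              rw [ENNReal.tsum_mul_left]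
              gcongr
              exact hts k
    _ = C * μH[d + 1] B := by
        refine Tendsto.liminf_eq ?_
        have := ENNReal.Tendsto.const_mul (a := C) (hr.const_add (μH[d + 1] B)) (Or.inr hC)
        simpa using this

/-! ### Zones of the unit sphere -/

/-- The part in a bounded ball of a slab of half-width `r` has volume `O(r)`: it lies in the product
of a segment of half-length `r` and a ball of the orthogonal hyperplane. -/
theorem exists_volume_slab_le {W : Type*} [NormedAddCommGroup W] [InnerProductSpace ℝ W]
    [FiniteDimensional ℝ W] [MeasurableSpace W] [BorelSpace W] {v : W} (hv : ‖v‖ = 1) (ρ : ℝ) :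
    ∃ C : ℝ≥0∞, C ≠ ⊤ ∧ ∀ r : ℝ, 0 ≤ r →
      (volume : Measure W) {y | ‖y‖ ≤ ρ ∧ |inner ℝ v y| ≤ r} ≤ C * ENNReal.ofReal r := by
  let s : Submodule ℝ W := ℝ ∙ v
  refine ⟨volume (ball (0 : s) 1) * volume (closedBall (0 : sᗮ) ρ),
    ENNReal.mul_ne_top measure_ball_lt_top.ne measure_closedBall_lt_top.ne, fun r hr => ?_⟩
  have hs : finrank ℝ s = 1 := finrank_span_singleton (by rintro rfl; simp at hv)
  have hmp := s.measurePreserving_measurableEquivProd (0 : W)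
  rw [InnerProductSpace.euclideanHausdorffMeasure_eq_volume] at hmp
  calc (volume : Measure W) {y | ‖y‖ ≤ ρ ∧ |inner ℝ v y| ≤ r}
      ≤ volume (s.measurableEquivProd (0 : W) ⁻¹' (closedBall (0 : s) r ×ˢ closedBall 0 ρ)) := by
        refine measure_mono fun y hy => ?_
        have h1 : ‖s.orthogonalProjectionOnto y‖ = |inner ℝ v y| := by
          rw [← Submodule.norm_coe, Submodule.coe_orthogonalProjectionOnto_apply,
            Submodule.starProjection_unit_singleton ℝ hv, norm_smul, hv, mul_one, Real.norm_eq_abs]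
        have h2 := sᗮ.norm_orthogonalProjectionOnto_apply_le y
        simp only [Set.mem_preimage, Submodule.measurableEquivProd_apply, vsub_eq_sub, sub_zero,
          Set.mem_prod, mem_closedBall_zero_iff]
        exact ⟨h1 ▸ hy.2, h2.trans hy.1⟩
    _ = volume (closedBall (0 : s) r) * volume (closedBall (0 : sᗮ) ρ) := by
        rw [hmp.measure_preimage_equiv, Measure.volume_eq_prod, Measure.prod_prod]
    _ = _ := by
        rw [Measure.addHaar_closedBall volume _ hr, hs, pow_one]
        ring

theorem LipschitzOnWith.euclideanHausdorffMeasure_image_le {X Y : Type*} [EMetricSpace X]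
    [MeasurableSpace X] [BorelSpace X] [EMetricSpace Y] [MeasurableSpace Y] [BorelSpace Y]
    {K : NNReal} {f : X → Y} {s : Set X} (h : LipschitzOnWith K f s) (d : ℕ) :
    μHE[d] (f '' s) ≤ (K : ℝ≥0∞) ^ d * μHE[d] s := by
  simp only [Measure.euclideanHausdorffMeasure_def, Measure.smul_apply, ENNReal.smul_def,
    smul_eq_mul]
  calc _ ≤ _ * ((K : ℝ≥0∞) ^ (d : ℝ) * μH[d] s) := by
        gcongr
        exact h.hausdorffMeasure_image_le (by positivity)
    _ = _ := by rw [ENNReal.rpow_natCast]; ring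

section
variable {V : Type*} [NormedAddCommGroup V] [InnerProductSpace ℝ V] [FiniteDimensional ℝ V]
  [MeasurableSpace V] [BorelSpace V]

/-- The slab estimate on the half of the unit sphere facing away from `w ⊥ v`: this half is the
image, under the inverse stereographic projection from `w`, of the ball of radius `2` in `wᗮ`,
where that map is Lipschitz and where `|⟪v, x⟫| ≤ r` pulls back into a slab of half-width `2 * r`.
-/
theorem exists_euclideanHausdorffMeasure_hemisphere_slab_le {m : ℕ} (hV : finrank ℝ V = m + 1)
    {v w : V} (hv : ‖v‖ = 1) (hw : ‖w‖ = 1) (hvw : inner ℝ w v = 0) :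
    ∃ C : ℝ≥0∞, C ≠ ⊤ ∧ ∀ r : ℝ, 0 ≤ r →
      μHE[m] {x : V | ‖x‖ = 1 ∧ inner ℝ w x ≤ 0 ∧ |inner ℝ v x| ≤ r} ≤ C * ENNReal.ofReal r := by
  let W : Submodule ℝ V := (ℝ ∙ w)ᗮ
  have hW : finrank ℝ W = m := by
    have : Fact (finrank ℝ V = m + 1) := ⟨hV⟩
    exact Submodule.finrank_orthogonal_span_singleton (by rintro rfl; simp at hw)
  let v' : W := ⟨v, Submodule.mem_orthogonal_singleton_iff_inner_right.2 hvw⟩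
  obtain ⟨C, hC, hCr⟩ := exists_volume_slab_le (v := v') hv 2
  let φ : W → V := fun y => stereoInvFunAux w y
  have hφ : ContDiff ℝ 1 φ := contDiff_stereoInvFunAux.comp W.subtypeL.contDiff
  obtain ⟨K, hK⟩ := hφ.locallyLipschitz.locallyLipschitzOn.exists_lipschitzOnWith_of_compact
    (isCompact_closedBall (0 : W) 2)
  refine ⟨(K : ℝ≥0∞) ^ m * (C * 2), by finiteness, fun r hr => ?_⟩
  let S : Set W := {y | ‖y‖ ≤ 2 ∧ |inner ℝ v' y| ≤ 2 * r}
  have hS : S ⊆ closedBall 0 2 := fun y hy => by simpa using hy.1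
  calc _ ≤ μHE[m] (φ '' S) := by
        refine measure_mono ?_
        rintro x ⟨hx, hwx, hvx⟩
        have hne : x ≠ w := by
          rintro rfl
          rw [real_inner_self_eq_norm_sq, hx] at hwx
          norm_num at hwx
        have h2 : |2 / (1 - inner ℝ w x)| ≤ 2 := by
          rw [abs_of_nonneg (by apply div_nonneg <;> linarith), div_le_iff₀ (by linarith)]
          linarith
        refine ⟨stereoToFun w x, ⟨?_, ?_⟩, ?_⟩
        · rw [stereoToFun_apply, norm_smul, innerSL_apply_apply, Real.norm_eq_abs]
          calc _ ≤ 2 * ‖x‖ := by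
                gcongr
                exact Submodule.norm_orthogonalProjectionOnto_apply_le _ _
            _ = 2 := by rw [hx, mul_one]
        · rw [stereoToFun_apply, inner_smul_right, innerSL_apply_apply,
            Submodule.inner_orthogonalProjectionOnto_eq_of_mem_left, abs_mul]
          gcongr
        · have := stereo_left_inv hw (x := ⟨x, by simpa using hx⟩) hne
          exact congrArg Subtype.val this
    _ ≤ (K : ℝ≥0∞) ^ m * μHE[m] S := (hK.mono hS).euclideanHausdorffMeasure_image_le m
    _ ≤ (K : ℝ≥0∞) ^ m * (C * ENNReal.ofReal (2 * r)) := by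
        gcongr
        have := hCr (2 * r) (by positivity)
        rwa [← InnerProductSpace.euclideanHausdorffMeasure_eq_volume, hW] at this
    _ = _ := by
        rw [ENNReal.ofReal_mul zero_le_two, ENNReal.ofReal_ofNat]
        ring

/-- The zone `|⟪v, x⟫| ≤ r` of the unit sphere has surface measure `O(r)`, uniformly in the unit
vector `v`. -/
theorem exists_euclideanHausdorffMeasure_sphere_slab_le {m : ℕ} (hV : finrank ℝ V = m + 1)
    (hm : 1 ≤ m) :
    ∃ C : ℝ≥0∞, C ≠ ⊤ ∧ ∀ v : V, ‖v‖ = 1 → ∀ r : ℝ, 0 ≤ r →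
      μHE[m] {x : V | ‖x‖ = 1 ∧ |inner ℝ v x| ≤ r} ≤ C * ENNReal.ofReal r := by
  let b := (stdOrthonormalBasis ℝ V).reindex (finCongr hV)
  let v₀ : V := b ⟨1, by omega⟩
  let w : V := b 0
  have hv₀ : ‖v₀‖ = 1 := b.norm_eq_one _
  have hw : ‖w‖ = 1 := b.norm_eq_one _
  have hvw : inner ℝ w v₀ = 0 := b.inner_eq_zero (by simp [Fin.ext_iff])
  obtain ⟨C₁, hC₁, h₁⟩ := exists_euclideanHausdorffMeasure_hemisphere_slab_le hV hv₀ hw hvw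
  obtain ⟨C₂, hC₂, h₂⟩ := exists_euclideanHausdorffMeasure_hemisphere_slab_le hV hv₀
    (w := -w) (by simpa using hw) (by simpa using hvw)
  refine ⟨C₁ + C₂, by finiteness, fun v hv r hr => ?_⟩
  -- A reflection moves `v` to the fixed vector `v₀`, so the constant does not depend on `v`.
  let R := (ℝ ∙ (v - v₀))ᗮ.reflection
  have hR : R v = v₀ := Submodule.reflection_sub (hv.trans hv₀.symm)
  calc _ = μHE[m] (R '' {x : V | ‖x‖ = 1 ∧ |inner ℝ v x| ≤ r}) :=
        (R.isometry.euclideanHausdorffMeasure_image _).symm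
    _ ≤ μHE[m] ({x : V | ‖x‖ = 1 ∧ inner ℝ w x ≤ 0 ∧ |inner ℝ v₀ x| ≤ r} ∪
          {x : V | ‖x‖ = 1 ∧ inner ℝ (-w) x ≤ 0 ∧ |inner ℝ v₀ x| ≤ r}) := by
        refine measure_mono ?_
        rintro _ ⟨x, ⟨hx, hvx⟩, rfl⟩
        have h1 : ‖R x‖ = 1 := by rw [R.norm_map, hx]
        have h2 : |inner ℝ v₀ (R x)| ≤ r := by rwa [← hR, R.inner_map_map]
        rcases le_total (inner ℝ w (R x)) 0 with h | h
        · exact Or.inl ⟨h1, h, h2⟩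
        · exact Or.inr ⟨h1, by simpa using h, h2⟩
    _ ≤ _ := (measure_union_le _ _).trans ((add_le_add (h₁ r hr) (h₂ r hr)).trans_eq (by ring))

theorem euclideanHausdorffMeasure_unit_sphere_lt_top {m : ℕ} (hV : finrank ℝ V = m + 1)
    (hm : 1 ≤ m) : μHE[m] (sphere (0 : V) 1) < ⊤ := by
  obtain ⟨C, hC, h⟩ := exists_euclideanHausdorffMeasure_sphere_slab_le hV hm
  have : Nontrivial V := nontrivial_of_finrank_pos (R := ℝ) (by omega)
  obtain ⟨v, hv⟩ := exists_norm_eq V zero_le_one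
  refine (measure_mono fun x hx => ?_).trans_lt ((h v hv 1 zero_le_one).trans_lt (by finiteness))
  have hx1 : ‖x‖ = 1 := by simpa using hx
  exact ⟨hx1, by simpa [hv, hx1] using abs_real_inner_le_norm v x⟩
end

/-! ### Parametrization of the slices -/

/-- The great sphere of the unit sphere orthogonal to `e`, as a subset of the ambient space. -/
def greatSphere {V : Type*} [NormedAddCommGroup V] [InnerProductSpace ℝ V] (e : V) : Set V :=
  {x | ‖x‖ = 1 ∧ inner ℝ e x = 0}

theorem isClosed_greatSphere {V : Type*} [NormedAddCommGroup V] [InnerProductSpace ℝ V] (e : V) :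
    IsClosed (greatSphere e) :=
  (isClosed_eq continuous_norm continuous_const).inter
    (isClosed_eq (by fun_prop) continuous_const)

section
variable {V : Type*} [NormedAddCommGroup V] [InnerProductSpace ℝ V]
  [MeasurableSpace V] [BorelSpace V]

open scoped Pointwise in
theorem euclideanHausdorffMeasure_similarity_image (d : ℕ) (p : V) {s : ℝ} (hs : 0 < s)
    (R : V ≃ₗᵢ[ℝ] V) (T : Set V) :
    μHE[d] ((fun x => p + s • R x) '' T) = ENNReal.ofReal s ^ d * μHE[d] T := by
  have h : (fun x => p + s • R x) '' T = (fun x => p + x) '' (s • (R '' T)) := by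
    rw [← Set.image_smul, Set.image_image, Set.image_image]
  rw [h, (isometry_add_left p).euclideanHausdorffMeasure_image,
    Measure.euclideanHausdorffMeasure_smul₀ d hs.ne',
    R.isometry.euclideanHausdorffMeasure_image, ENNReal.smul_def, smul_eq_mul, ENNReal.coe_pow]
  congr 2
  rw [← enorm_eq_nnnorm, Real.enorm_of_nonneg hs.le]

theorem restrict_euclideanHausdorffMeasure_similarity_image (d : ℕ) (p : V) {s : ℝ} (hs : 0 < s)
    (R : V ≃ₗᵢ[ℝ] V) (K : Set V) :
    (μHE[d] : Measure V).restrict ((fun x => p + s • R x) '' K) =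
      ENNReal.ofReal s ^ d • ((μHE[d] : Measure V).restrict K).map (fun x => p + s • R x) := by
  have hm : Measurable fun x => p + s • R x :=
    (continuous_const.add (R.continuous.const_smul s)).measurable
  ext B hB
  rw [Measure.restrict_apply hB, Measure.smul_apply, Measure.map_apply hm hB,
    Measure.restrict_apply (hm hB), smul_eq_mul,
    ← euclideanHausdorffMeasure_similarity_image d p hs, Set.image_preimage_inter]

theorem euclideanHausdorffMeasure_greatSphere_lt_top [FiniteDimensional ℝ V] {m : ℕ}
    (hV : finrank ℝ V = m + 2) (hm : 1 ≤ m) {e : V} (he : ‖e‖ = 1) :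
    μHE[m] (greatSphere e) < ⊤ := by
  let W : Submodule ℝ V := (ℝ ∙ e)ᗮ
  have hW : finrank ℝ W = m + 1 := by
    have : Fact (finrank ℝ V = m + 1 + 1) := ⟨hV⟩
    exact Submodule.finrank_orthogonal_span_singleton (by rintro rfl; simp at he)
  have h := euclideanHausdorffMeasure_unit_sphere_lt_top hW hm
  rw [← W.subtypeₗᵢ.isometry.euclideanHausdorffMeasure_image] at h
  refine (measure_mono ?_).trans_lt h
  rintro x ⟨hx, hex⟩
  exact ⟨⟨x, Submodule.mem_orthogonal_singleton_iff_inner_right.2 hex⟩, by simpa using hx, rfl⟩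

theorem euclideanHausdorffMeasure_greatSphere_eq (d : ℕ) {e e' : V} (he : ‖e‖ = 1)
    (he' : ‖e'‖ = 1) : μHE[d] (greatSphere e) = μHE[d] (greatSphere e') := by
  let R := (ℝ ∙ (e - e'))ᗮ.reflection
  have hR : R e = e' := Submodule.reflection_sub (he.trans he'.symm)
  rw [← R.isometry.euclideanHausdorffMeasure_image]
  congr 1
  ext x
  constructor
  · rintro ⟨y, ⟨hy, hey⟩, rfl⟩
    exact ⟨by rw [R.norm_map, hy], by rw [← hR, R.inner_map_map, hey]⟩
  · rintro ⟨hx, hex⟩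
    refine ⟨R.symm x, ⟨by rw [R.symm.norm_map, hx], ?_⟩, R.apply_symm_apply x⟩
    rw [← R.inner_map_map, hR, R.apply_symm_apply, hex]
end

namespace SphericalSlice

/-- The Euclidean space `ℝⁿ⁺¹` that contains `Sⁿ`. -/
abbrev Ambient (n : ℕ) : Type := EuclideanSpace ℝ (Fin (n + 1))

theorem norm_pointA (n : ℕ) (a : ℝ) : ‖pointA n a‖ = |a| := by
  simp [pointA]

theorem abs_inner_pointA_le {n : ℕ} (a : ℝ) (ξ : Sn n) :
    |inner ℝ (ξ : Ambient n) (pointA n a)| ≤ |a| := by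
  simpa [norm_pointA] using
    abs_real_inner_le_norm (ξ : Ambient n) (pointA n a)

/-- The radius `√(1 - ⟪ξ, A⟫²)` of the slice with normal `ξ`, as a function on the ambient space. -/
noncomputable def sliceRadius {n : ℕ} (a : ℝ) (ξ : Ambient n) : ℝ :=
  √(1 - inner ℝ ξ (pointA n a) ^ 2)

/-- The similarity `y ↦ ⟪ξ, A⟫ ξ + √(1 - ⟪ξ, A⟫²) y`. For a unit vector `ξ` it maps the great sphere
orthogonal to `ξ` onto the slice with normal `ξ`. -/
noncomputable def slicePoint {n : ℕ} (a : ℝ) (ξ y : Ambient n) : Ambient n :=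
  inner ℝ ξ (pointA n a) • ξ + sliceRadius a ξ • y

theorem continuous_slicePoint {n : ℕ} (a : ℝ) (ξ : Ambient n) : Continuous (slicePoint a ξ) :=
  continuous_const.add (continuous_const_smul _)

theorem one_sub_inner_pointA_sq_pos {n : ℕ} {a : ℝ} (ha : |a| < 1) (ξ : Sn n) :
    0 < 1 - inner ℝ (ξ : Ambient n) (pointA n a) ^ 2 := by
  have := (abs_inner_pointA_le a ξ).trans_lt ha
  rw [← sq_lt_one_iff_abs_lt_one] at this
  linarith

theorem sliceRadius_pos {n : ℕ} {a : ℝ} (ha : |a| < 1) (ξ : Sn n) :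
    0 < sliceRadius a (ξ : Ambient n) :=
  Real.sqrt_pos.2 (one_sub_inner_pointA_sq_pos ha ξ)

theorem sliceRadius_le_one {n : ℕ} (a : ℝ) (ξ : Ambient n) :
    sliceRadius a ξ ≤ 1 := by
  rw [sliceRadius, Real.sqrt_le_one]
  nlinarith [sq_nonneg (inner ℝ ξ (pointA n a))]

/-- The slice with normal `ξ` is parametrized by the great sphere orthogonal to a fixed vector `e`,
which an isometry `R` with `R e = ξ` carries to the great sphere orthogonal to `ξ`. -/
theorem image_coe_slice {n : ℕ} {a : ℝ} (ha : |a| < 1) (ξ : Sn n)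
    {e : Ambient n}
    (R : Ambient n ≃ₗᵢ[ℝ] Ambient n)
    (hR : R e = ξ) :
    ((↑) '' slice a ξ : Set (Ambient n)) =
      (fun x => slicePoint a (ξ : Ambient n) (R x)) '' greatSphere e := by
  unfold slicePoint
  have hs := sliceRadius_pos ha ξ
  have hs2 : sliceRadius a (ξ : Ambient n) ^ 2 = _ :=
    Real.sq_sqrt (one_sub_inner_pointA_sq_pos ha ξ).le
  set s := sliceRadius a (ξ : Ambient n)
  set c : ℝ := inner ℝ (ξ : Ambient n) (pointA n a) with hc
  have hξ : ‖(ξ : Ambient n)‖ = 1 := by simp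
  have hξξ : inner ℝ (ξ : Ambient n) ξ = (1 : ℝ) := by
    rw [real_inner_self_eq_norm_sq, hξ, one_pow]
  ext y
  constructor
  · rintro ⟨η, hη, rfl⟩
    have hη1 : inner ℝ (ξ : Ambient n) η = c := by
      have : inner ℝ (ξ : Ambient n) (η - pointA n a) = 0 := hη
      rwa [inner_sub_right, sub_eq_zero] at this
    have hη2 : ‖(η : Ambient n)‖ = 1 := by simp
    refine ⟨R.symm (s⁻¹ • (η - c • ξ)), ⟨?_, ?_⟩, ?_⟩
    · rw [R.symm.norm_map, norm_smul, norm_inv, Real.norm_of_nonneg hs.le,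
        inv_mul_eq_one₀ hs.ne', ← sq_eq_sq₀ hs.le (norm_nonneg _), hs2, norm_sub_sq_real, norm_smul,
        inner_smul_right, real_inner_comm, hη1, hη2, hξ, Real.norm_eq_abs, mul_one, sq_abs]
      ring
    · rw [← R.inner_map_map, hR, R.apply_symm_apply, inner_smul_right, inner_sub_right,
        inner_smul_right, hη1, hξξ]
      ring
    · simp [smul_smul, hs.ne']
  · rintro ⟨x, ⟨hx, hex⟩, rfl⟩
    have h1 : inner ℝ (ξ : Ambient n) (R x) = (0 : ℝ) := by
      rw [← hR, R.inner_map_map, hex]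
    have h2 : ‖c • (ξ : Ambient n) + s • R x‖ = 1 := by
      rw [← sq_eq_sq₀ (norm_nonneg _) zero_le_one, norm_add_sq_real, norm_smul, norm_smul,
        R.norm_map, hx, hξ, inner_smul_left, inner_smul_right, h1, Real.norm_eq_abs,
        Real.norm_eq_abs, mul_one, mul_one, sq_abs, sq_abs, hs2]
      simp
    refine ⟨⟨_, by simpa using h2⟩, ?_, rfl⟩
    change inner ℝ (ξ : Ambient n) (_ - pointA n a) = 0
    rw [inner_sub_right, inner_add_right, inner_smul_right, inner_smul_right, h1, hξξ]
    simp [hc]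

/-- The area of the slice is the area of a fixed great sphere, moved by the parametrization and
scaled by the `(n - 1)`-st power of the radius. -/
theorem map_coe_sliceMeasure {n : ℕ} {a : ℝ} (ha : |a| < 1) (ξ : Sn n)
    {e : Ambient n}
    (R : Ambient n ≃ₗᵢ[ℝ] Ambient n)
    (hR : R e = ξ) :
    (sliceMeasure a ξ).map ((↑) : Sn n → Ambient n) =
      ENNReal.ofReal (sliceRadius a (ξ : Ambient n)) ^ (n - 1) •
        ((μHE[n - 1] : Measure (Ambient n)).restrict (greatSphere e)).map
          (fun x => slicePoint a (ξ : Ambient n) (R x)) := by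
  have h := restrict_euclideanHausdorffMeasure_similarity_image (n - 1)
    (inner ℝ (ξ : Ambient n) (pointA n a) • (ξ : Ambient n)) (sliceRadius_pos ha ξ) R
    (greatSphere e)
  refine Eq.trans ?_ h
  change _ = (μHE[n - 1]).restrict ((fun x => slicePoint a (ξ : Ambient n) (R x)) '' greatSphere e)
  rw [← image_coe_slice ha ξ R hR]
  ext B hB
  have hm : Measurable ((↑) : Sn n → Ambient n) := measurable_subtype_coe
  rw [Measure.map_apply hm hB, sliceMeasure, Measure.restrict_apply (hm hB),
    Measure.restrict_apply hB, ← isometry_subtype_coe.euclideanHausdorffMeasure_image,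
    Set.image_preimage_inter]

/-- The areas of the slices are bounded, by the area of a great sphere. -/
theorem exists_sliceMeasure_univ_le {n : ℕ} (hn : 2 ≤ n) {a : ℝ} (ha : |a| < 1) :
    ∃ M : ℝ≥0∞, M ≠ ⊤ ∧ ∀ ξ : Sn n, sliceMeasure a ξ Set.univ ≤ M := by
  let e₀ : Ambient n := EuclideanSpace.single 0 1
  have he₀ : ‖e₀‖ = 1 := by simp [e₀]
  refine ⟨μHE[n - 1] (greatSphere e₀), (euclideanHausdorffMeasure_greatSphere_lt_top
    (by simp; omega) (by omega) he₀).ne, fun ξ => ?_⟩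
  have hm : Measurable ((↑) : Sn n → Ambient n) := measurable_subtype_coe
  have hR : Measurable fun x : Ambient n =>
      slicePoint a (ξ : Ambient n) (LinearIsometryEquiv.refl ℝ _ x) :=
    ((continuous_slicePoint a _).comp (LinearIsometryEquiv.refl ℝ _).continuous).measurable
  have h := congrArg (fun ν => ν Set.univ) (map_coe_sliceMeasure ha ξ (e := ξ)
    (LinearIsometryEquiv.refl ℝ _) rfl)
  simp only [Measure.map_apply hm .univ, Set.preimage_univ, Measure.smul_apply] at h
  rw [h, Measure.map_apply hR .univ, Set.preimage_univ, Measure.restrict_apply_univ,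
    euclideanHausdorffMeasure_greatSphere_eq _ (by simp) he₀, smul_eq_mul]
  refine mul_le_of_le_one_left' (pow_le_one₀ zero_le ?_)
  exact ENNReal.ofReal_le_one.2 (sliceRadius_le_one a _)

theorem integral_sliceMeasure {G : Type*} [NormedAddCommGroup G] [NormedSpace ℝ G]
    {n : ℕ} {a : ℝ} (ha : |a| < 1) (ξ : Sn n)
    {e : Ambient n}
    (R : Ambient n ≃ₗᵢ[ℝ] Ambient n)
    (hR : R e = ξ) {g : Ambient n → G} (hg : Continuous g) :
    ∫ η, g η ∂(sliceMeasure a ξ) =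
      sliceRadius a (ξ : Ambient n) ^ (n - 1) •
        ∫ x in greatSphere e, g (slicePoint a (ξ : Ambient n) (R x)) ∂μHE[n - 1] := by
  have hm : Measurable ((↑) : Sn n → Ambient n) := measurable_subtype_coe
  have hR' : Measurable fun x => slicePoint a (ξ : Ambient n) (R x) :=
    ((continuous_slicePoint a _).comp R.continuous).measurable
  have h1 := integral_map (μ := sliceMeasure a ξ) hm.aemeasurable hg.aestronglyMeasurable
  have h2 := integral_map (μ := (μHE[n - 1] : Measure (Ambient n)).restrict (greatSphere e))
    hR'.aemeasurable hg.aestronglyMeasurable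
  rw [← h1, ← h2, map_coe_sliceMeasure ha ξ R hR, integral_smul_measure, ENNReal.toReal_pow,
    ENNReal.toReal_ofReal (sliceRadius_pos ha ξ).le]

end SphericalSlice

/-! ### Regularity of the slice integrals -/

/-- Smooth dependence on parameters of an integral against a finite measure, which need not be
related to the Haar measure: it is the value at `0` of a convolution with the constant `1`. -/
theorem contDiffOn_integral_of_compact_support {P G F : Type*} [NormedAddCommGroup P]
    [NormedSpace ℝ P] [NormedAddCommGroup G] [NormedSpace ℝ G] [MeasurableSpace G] [BorelSpace G]
    [NormedAddCommGroup F] [NormedSpace ℝ F] {m : ℕ∞} (μ : Measure G) [IsFiniteMeasure μ]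
    {g : P → G → F} {s : Set P} {k : Set G} (hs : IsOpen s) (hk : IsCompact k)
    (hgs : ∀ p, ∀ x, p ∈ s → x ∉ k → g p x = 0)
    (hg : ContDiffOn ℝ m (fun q : P × G => g q.1 q.2) (s ×ˢ Set.univ)) :
    ContDiffOn ℝ m (fun p => ∫ x, g p x ∂μ) s := by
  -- The convolution at `0` evaluates the second factor at `-x`.
  let g' : P → G → F := fun p x => g p (-x)
  have hg' : ContDiffOn ℝ m ↿g' (s ×ˢ Set.univ) := by
    have : ContDiff ℝ m fun q : P × G => (q.1, -q.2) := contDiff_fst.prodMk contDiff_snd.neg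
    exact hg.comp this.contDiffOn fun q hq => ⟨hq.1, trivial⟩
  have h := contDiffOn_convolution_right_with_param_comp (𝕜 := ℝ) (μ := μ)
    (f := fun _ : G => (1 : ℝ)) (ContinuousLinearMap.lsmul ℝ ℝ (E := F)) (v := fun _ : P => (0 : G))
    contDiffOn_const hs (hk.neg) (g := g')
    (fun p x hp hx => hgs p (-x) hp (by simpa using hx))
    (integrable_const (1 : ℝ)).locallyIntegrable hg'
  simpa [convolution_def, g'] using h

theorem reflection_orthogonal_singleton_apply {V : Type*} [NormedAddCommGroup V]
    [InnerProductSpace ℝ V] (u v : V) :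
    (ℝ ∙ u)ᗮ.reflection v = v - (2 * (inner ℝ u v / ‖u‖ ^ 2)) • u := by
  rw [Submodule.reflection_orthogonal_apply, Submodule.reflection_singleton_apply]
  rw [← Nat.cast_smul_eq_nsmul ℝ, smul_smul, neg_sub]
  simp

namespace SphericalSlice

/-- Integrating a `C^m` function of the ambient space over the slices gives a `C^m` function of the
normal. The case `m = 0` is continuity. -/
theorem contMDiff_integral_sliceMeasure {F : Type*} [NormedAddCommGroup F] [NormedSpace ℝ F]
    {n : ℕ} (hn : 2 ≤ n) {a : ℝ} (ha : |a| < 1) {m : ℕ∞} {g : Ambient n → F}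
    (hg : ContDiff ℝ m g) :
    ContMDiff (𝓡 n) 𝓘(ℝ, F) m fun ξ : Sn n => ∫ η, g η ∂(sliceMeasure a ξ) := by
  have := Fact.mk (@finrank_euclideanSpace_fin ℝ _ (n + 1))
  intro ξ₀
  -- Near `ξ₀`, the reflection that exchanges `-ξ₀` and `ξ` depends smoothly on `ξ`.
  let e : Ambient n := -ξ₀
  have he : ‖e‖ = 1 := by simp [e]
  let U : Set (Ambient n) := {ξ | ξ ≠ e} ∩ {ξ | inner ℝ ξ (pointA n a) ^ 2 < 1}
  have hU : IsOpen U := isOpen_ne.inter (isOpen_lt (by fun_prop) continuous_const)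
  have hξ₀ : (ξ₀ : Ambient n) ∈ U := by
    refine ⟨?_, ?_⟩
    · exact fun h => ne_neg_of_mem_unit_sphere ℝ ξ₀ (Subtype.ext h)
    · have := one_sub_inner_pointA_sq_pos ha ξ₀
      simp only [Set.mem_ofPred_eq]
      linarith
  -- The cutoff is `1` on the unit sphere; it provides the compact support in `x`.
  let χ : ContDiffBump (0 : Ambient n) := ⟨2, 3, by norm_num, by norm_num⟩
  let ν : Measure (Ambient n) := (μHE[n - 1] : Measure (Ambient n)).restrict (greatSphere e)
  have hν : IsFiniteMeasure ν := ⟨by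
    rw [Measure.restrict_apply_univ]
    exact euclideanHausdorffMeasure_greatSphere_lt_top (by simp; omega) (by omega) he⟩
  let G : Ambient n → Ambient n → F := fun ξ x =>
    χ x • g (slicePoint a ξ (x - (2 * (inner ℝ (e - ξ) x / ‖e - ξ‖ ^ 2)) • (e - ξ)))
  have hrad : ContDiffOn ℝ m (sliceRadius a) U := by
    refine ContDiffOn.sqrt (contDiff_const.sub
      ((contDiff_id.inner ℝ contDiff_const).pow 2)).contDiffOn fun ξ hξ => ?_
    have := hξ.2
    simp only [Set.mem_ofPred_eq] at this
    linarith
  have hG : ContDiffOn ℝ m (fun q : Ambient n × Ambient n => G q.1 q.2) (U ×ˢ Set.univ) := by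
    have h1 : ContDiffOn ℝ m (fun q : Ambient n × Ambient n => sliceRadius a q.1)
        (U ×ˢ Set.univ) := hrad.comp contDiff_fst.contDiffOn fun q hq => hq.1
    have h2 : ContDiffOn ℝ m (fun q : Ambient n × Ambient n =>
        inner ℝ (e - q.1) q.2 / ‖e - q.1‖ ^ 2) (U ×ˢ Set.univ) := by
      refine ContDiffOn.div
        ((contDiff_const.sub contDiff_fst).inner ℝ contDiff_snd).contDiffOn
        (ContDiff.contDiffOn ?_) ?_
      · exact (contDiff_const.sub contDiff_fst).norm_sq ℝ
      · intro q hq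
        have : e - q.1 ≠ 0 := sub_ne_zero.2 (Ne.symm hq.1.1)
        positivity
    have h3 : ContDiffOn ℝ m (fun q : Ambient n × Ambient n =>
        slicePoint a q.1 (q.2 - (2 * (inner ℝ (e - q.1) q.2 / ‖e - q.1‖ ^ 2)) • (e - q.1)))
        (U ×ˢ Set.univ) := by
      refine ContDiffOn.add
        ((contDiff_fst.inner ℝ contDiff_const).smul contDiff_fst).contDiffOn (h1.smul ?_)
      exact contDiff_snd.contDiffOn.sub
        ((contDiffOn_const.mul h2).smul (contDiff_const.sub contDiff_fst).contDiffOn)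
    exact (χ.contDiff.comp contDiff_snd).contDiffOn.smul (hg.comp_contDiffOn h3)
  have hsupp : ∀ ξ x, ξ ∈ U → x ∉ closedBall (0 : Ambient n) 3 → G ξ x = 0 := by
    intro ξ x _ hx
    have : χ x = 0 := χ.zero_of_le_dist (le_of_lt (by simpa using hx))
    simp [G, this]
  have hint := contDiffOn_integral_of_compact_support ν hU (isCompact_closedBall _ _) hsupp hG
  have hH : ContDiffOn ℝ m (fun ξ => sliceRadius a ξ ^ (n - 1) • ∫ x, G ξ x ∂ν) U :=
    (hrad.pow _).smul hint
  have hcomp : ContMDiffAt (𝓡 n) 𝓘(ℝ, F) m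
      (fun ξ : Sn n => sliceRadius a (ξ : Ambient n) ^ (n - 1) • ∫ x, G ξ x ∂ν) ξ₀ :=
    (hH.contDiffAt (hU.mem_nhds hξ₀)).contMDiffAt.comp ξ₀ contMDiff_coe_sphere.contMDiffAt
  refine hcomp.congr_of_eventuallyEq ?_
  filter_upwards [(hU.preimage continuous_subtype_val).mem_nhds hξ₀] with ξ hξ
  let R := (ℝ ∙ (e - (ξ : Ambient n)))ᗮ.reflection
  have hR : R e = ξ := Submodule.reflection_sub (he.trans (by simp))
  rw [integral_sliceMeasure ha ξ R hR hg.continuous]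
  congr 1
  refine setIntegral_congr_fun (isClosed_greatSphere e).measurableSet fun x hx => ?_
  have : χ x = 1 := χ.one_of_mem_closedBall (by simp [hx.1, χ])
  simp only [G, this, one_smul, R, reflection_orthogonal_singleton_apply]

/-- A `C^m` function on the sphere extends to the ambient space, as `ρ (‖x‖²) f (x / ‖x‖)` with a
bump function `ρ` around `1` which vanishes near `0`. -/
theorem exists_contDiff_extension {F : Type*} [NormedAddCommGroup F] [NormedSpace ℝ F]
    {n : ℕ} {m : ℕ∞} {f : Sn n → F} (hf : ContMDiff (𝓡 n) 𝓘(ℝ, F) m f) :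
    ∃ g : Ambient n → F, ContDiff ℝ m g ∧ ∀ η : Sn n, g η = f η := by
  have := Fact.mk (@finrank_euclideanSpace_fin ℝ _ (n + 1))
  classical
  let U : TopologicalSpace.Opens (Ambient n) := ⟨{x | x ≠ 0}, isOpen_ne⟩
  let N : U → Ambient n := fun x => ‖(x : Ambient n)‖⁻¹ • (x : Ambient n)
  have hN : ContMDiff 𝓘(ℝ, Ambient n) 𝓘(ℝ, Ambient n) m N := by
    intro x
    have h : ContDiffAt ℝ m (fun x : Ambient n => ‖x‖⁻¹ • x) x :=
      ((contDiffAt_norm ℝ x.2).inv (norm_ne_zero_iff.2 x.2)).smul contDiffAt_id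
    exact h.contMDiffAt.comp x (contMDiff_subtype_val x)
  have hN1 : ∀ x, N x ∈ sphere (0 : Ambient n) 1 := fun x => by
    simpa [N] using norm_smul_inv_norm (𝕜 := ℝ) x.2
  have hfN : ContMDiff 𝓘(ℝ, Ambient n) 𝓘(ℝ, F) m (f ∘ Set.codRestrict N _ hN1) :=
    hf.comp (hN.codRestrict_sphere hN1)
  let ρ : ContDiffBump (1 : ℝ) := ⟨1 / 4, 1 / 2, by norm_num, by norm_num⟩
  -- The value of the normalization at `0` is irrelevant.
  let nrm : Ambient n → Sn n := fun x =>
    if hx : x ∈ U then Set.codRestrict N _ hN1 ⟨x, hx⟩ else ⟨EuclideanSpace.single 0 1, by simp⟩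
  refine ⟨fun x => ρ (‖x‖ ^ 2) • f (nrm x), contDiff_iff_contDiffAt.2 fun x => ?_, fun η => ?_⟩
  · by_cases hx : x = 0
    · refine (contDiffAt_const (c := (0 : F))).congr_of_eventuallyEq ?_
      filter_upwards [ball_mem_nhds x (ε := 1 / 2) (by norm_num)] with y hy
      have hy' : ‖y‖ < 1 / 2 := by simpa [hx] using hy
      have : ρ (‖y‖ ^ 2) = 0 := by
        refine ρ.zero_of_le_dist ?_
        rw [Real.dist_eq, abs_sub_comm]
        refine le_trans ?_ (le_abs_self _)
        change (1 / 2 : ℝ) ≤ _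
        nlinarith [norm_nonneg y]
      rw [this, zero_smul]
    · refine ContDiffAt.smul (ρ.contDiff.contDiffAt.comp x (contDiff_norm_sq ℝ).contDiffAt) ?_
      have h := hfN ⟨x, hx⟩
      have h' : ContMDiffAt 𝓘(ℝ, Ambient n) 𝓘(ℝ, F) m ((f ∘ nrm) ∘ ((↑) : U → Ambient n))
          ⟨x, hx⟩ := by
        convert h using 1
        ext y
        simp [nrm, y.2]
      exact (contMDiffAt_subtype_iff.1 h').contDiffAt
  · change ρ (‖(η : Ambient n)‖ ^ 2) • f (nrm η) = f η
    have h1 : ρ (‖(η : Ambient n)‖ ^ 2) = 1 :=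
      ρ.one_of_mem_closedBall (by simp [ρ])
    have h2 : nrm η = η := by
      have : (η : Ambient n) ∈ U := ne_zero_of_mem_unit_sphere η
      ext1
      simp [nrm, this, N]
    rw [h1, h2, one_smul]

end SphericalSlice

/-! ### Integral operators on `L^p` defined by a kernel -/

theorem one_sub_one_div_toReal_nonneg {p : ℝ≥0∞} (hp : 1 ≤ p) : 0 ≤ 1 - 1 / p.toReal := by
  rcases eq_or_ne p ⊤ with rfl | hpt
  · simp
  · have : 1 ≤ p.toReal := by simpa using ENNReal.toReal_mono hpt hp
    rw [sub_nonneg, div_le_one (by linarith)]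
    exact this

section
variable {X G : Type*} [MeasurableSpace X] [NormedAddCommGroup G] {σ : Measure X} {κ : Kernel X X}
  {C : ℝ≥0∞}

/-- If `κ ∘ₘ σ` is dominated by `σ`, then a `σ`-null set is `κ ξ`-null for `σ`-almost every `ξ`.
This is why integrating a class of functions modulo `σ` against `κ ξ` makes sense. -/
theorem ae_ae_kernel_of_comp_le (h : κ ∘ₘ σ ≤ C • σ) {P : X → Prop} (hP : ∀ᵐ η ∂σ, P η) :
    ∀ᵐ ξ ∂σ, ∀ᵐ η ∂(κ ξ), P η :=
  Measure.ae_ae_of_ae_comp ((Measure.absolutelyContinuous_of_le_smul h).ae_le hP)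

theorem ae_integrable_kernel [IsFiniteMeasure σ] [IsFiniteKernel κ] (hC : C ≠ ⊤)
    (h : κ ∘ₘ σ ≤ C • σ) {p : ℝ≥0∞} (hp : 1 ≤ p) {f : X → G} (hf : MemLp f p σ) :
    ∀ᵐ ξ ∂σ, Integrable f (κ ξ) :=
  Measure.ae_integrable_of_integrable_comp ((hf.of_measure_le_smul hC h).integrable hp)

variable [NormedSpace ℝ G]

theorem aestronglyMeasurable_integral_kernel (h : κ ∘ₘ σ ≤ C • σ) {f : X → G}
    (hf : AEStronglyMeasurable f σ) : AEStronglyMeasurable (fun ξ => ∫ η, f η ∂(κ ξ)) σ :=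
  ⟨fun ξ => ∫ η, hf.mk f η ∂(κ ξ), hf.stronglyMeasurable_mk.integral_kernel, by
    filter_upwards [ae_ae_kernel_of_comp_le h hf.ae_eq_mk] with _ hx using integral_congr_ae hx⟩

/-- The Schur-type bound: for each `ξ`, Hölder's inequality for the finite measure `κ ξ` bounds the
integral of `f` by the `L^p(κ ξ)` norm, and these norms are integrated using `κ ∘ₘ σ ≤ C • σ`. -/
theorem eLpNorm_integral_kernel_le [IsFiniteKernel κ] (h : κ ∘ₘ σ ≤ C • σ)
    {p : ℝ≥0∞} (hp : 1 ≤ p) {f : X → G} (hf : AEStronglyMeasurable f σ) :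
    eLpNorm (fun ξ => ∫ η, f η ∂(κ ξ)) p σ ≤
      κ.bound ^ (1 - 1 / p.toReal) * C ^ (1 / p).toReal * eLpNorm f p σ := by
  have hfκ : AEStronglyMeasurable f (κ ∘ₘ σ) :=
    hf.mono_ac (Measure.absolutelyContinuous_of_le_smul h)
  have hpr := one_sub_one_div_toReal_nonneg hp
  have hpt : ∀ᵐ ξ ∂σ, ‖∫ η, f η ∂(κ ξ)‖ₑ ≤ κ.bound ^ (1 - 1 / p.toReal) * eLpNorm f p (κ ξ) := by
    filter_upwards [ae_ae_kernel_of_comp_le h hf.ae_eq_mk] with ξ hξ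
    have hfξ : AEStronglyMeasurable f (κ ξ) := ⟨_, hf.stronglyMeasurable_mk, hξ⟩
    calc ‖∫ η, f η ∂(κ ξ)‖ₑ ≤ eLpNorm f 1 (κ ξ) := by
          rw [eLpNorm_one_eq_lintegral_enorm]
          exact enorm_integral_le_lintegral_enorm f
      _ ≤ eLpNorm f p (κ ξ) * κ ξ Set.univ ^ (1 - 1 / p.toReal) := by
          simpa using eLpNorm_le_eLpNorm_mul_rpow_measure_univ hp hfξ
      _ ≤ _ := by
          rw [mul_comm]
          gcongr
          exact κ.measure_le_bound ξ _
  rcases eq_or_ne p ⊤ with rfl | hp_top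
  · rw [eLpNorm_exponent_top, eLpNormEssSup]
    refine essSup_le_of_ae_le _ ?_
    filter_upwards [hpt, ae_ae_kernel_of_comp_le h (enorm_ae_le_eLpNormEssSup f σ)] with ξ h1 h2
    refine h1.trans ?_
    simp only [ENNReal.toReal_top, ENNReal.div_top, ENNReal.toReal_zero, ENNReal.rpow_zero, mul_one]
    refine mul_le_mul_right ?_ _
    rw [eLpNorm_exponent_top, eLpNormEssSup]
    exact essSup_le_of_ae_le _ h2
  · have hp0 : p ≠ 0 := (zero_lt_one.trans_le hp).ne'
    have hp' : 0 < p.toReal := ENNReal.toReal_pos hp0 hp_top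
    have hcomp : eLpNorm f p (κ ∘ₘ σ) ≤ C ^ (1 / p).toReal * eLpNorm f p σ :=
      eLpNorm_le_of_measure_le_smul h
    rw [mul_assoc]
    refine le_trans ?_ (mul_le_mul_right hcomp _)
    rw [eLpNorm_eq_lintegral_rpow_enorm_toReal hp0 hp_top,
      eLpNorm_eq_lintegral_rpow_enorm_toReal hp0 hp_top, one_div, ENNReal.rpow_inv_le_iff hp',
      ENNReal.mul_rpow_of_nonneg _ _ hp'.le, ENNReal.rpow_inv_rpow hp'.ne',
      Measure.lintegral_bind κ.aemeasurable (hfκ.enorm.pow_const _)]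
    calc ∫⁻ ξ, ‖∫ η, f η ∂(κ ξ)‖ₑ ^ p.toReal ∂σ
        ≤ ∫⁻ ξ, (κ.bound ^ (1 - 1 / p.toReal)) ^ p.toReal *
            ∫⁻ η, ‖f η‖ₑ ^ p.toReal ∂(κ ξ) ∂σ := by
          refine lintegral_mono_ae ?_
          filter_upwards [hpt] with ξ hξ
          refine (ENNReal.rpow_le_rpow hξ hp'.le).trans_eq ?_
          rw [ENNReal.mul_rpow_of_nonneg _ _ hp'.le,
            eLpNorm_eq_lintegral_rpow_enorm_toReal hp0 hp_top, one_div,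
            ENNReal.rpow_inv_rpow hp'.ne']
      _ = _ := by
          rw [lintegral_const_mul' _ _ (by
            have := κ.bound_ne_top
            have : κ.bound ^ (1 - 1 / p.toReal) ≠ ⊤ := ENNReal.rpow_ne_top_of_nonneg hpr this
            exact ENNReal.rpow_ne_top_of_nonneg hp'.le this)]
          simp

end

theorem exists_continuousLinearMap_Lp_integral_kernel {𝕜 X : Type*} [RCLike 𝕜] [MeasurableSpace X]
    {σ : Measure X} [IsFiniteMeasure σ] {κ : Kernel X X} [IsFiniteKernel κ] {C : ℝ≥0∞} (hC : C ≠ ⊤)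
    (h : κ ∘ₘ σ ≤ C • σ) (p : ℝ≥0∞) [hp : Fact (1 ≤ p)] :
    ∃ T : Lp 𝕜 p σ →L[𝕜] Lp 𝕜 p σ, ∀ (f : X → 𝕜) (hf : MemLp f p σ),
      (T (hf.toLp f) : X → 𝕜) =ᵐ[σ] fun ξ => ∫ η, f η ∂(κ ξ) := by
  let K : ℝ≥0∞ := κ.bound ^ (1 - 1 / p.toReal) * C ^ (1 / p).toReal
  have hK : K ≠ ⊤ :=
    ENNReal.mul_ne_top
      (ENNReal.rpow_ne_top_of_nonneg (one_sub_one_div_toReal_nonneg hp.out) κ.bound_ne_top)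
      (ENNReal.rpow_ne_top_of_nonneg (by positivity) hC)
  have hle : ∀ f : X → 𝕜, AEStronglyMeasurable f σ →
      eLpNorm (fun ξ => ∫ η, f η ∂(κ ξ)) p σ ≤ K * eLpNorm f p σ :=
    fun f hf => eLpNorm_integral_kernel_le h hp.out hf
  have hmem : ∀ f : X → 𝕜, MemLp f p σ → MemLp (fun ξ => ∫ η, f η ∂(κ ξ)) p σ := fun f hf =>
    ⟨aestronglyMeasurable_integral_kernel h hf.1,
      (hle f hf.1).trans_lt (ENNReal.mul_lt_top hK.lt_top hf.2)⟩
  have hcongr : ∀ f g : X → 𝕜, f =ᵐ[σ] g →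
      (fun ξ => ∫ η, f η ∂(κ ξ)) =ᵐ[σ] fun ξ => ∫ η, g η ∂(κ ξ) := fun f g hfg => by
    filter_upwards [ae_ae_kernel_of_comp_le h hfg] with ξ hξ using integral_congr_ae hξ
  let L : Lp 𝕜 p σ →ₗ[𝕜] Lp 𝕜 p σ :=
    { toFun := fun f => (hmem f (Lp.memLp f)).toLp
      map_add' := fun f g => by
        rw [← MemLp.toLp_add, MemLp.toLp_eq_toLp_iff]
        refine (hcongr _ _ (Lp.coeFn_add f g)).trans ?_
        filter_upwards [ae_integrable_kernel hC h hp.out (Lp.memLp f),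
          ae_integrable_kernel hC h hp.out (Lp.memLp g)] with ξ h1 h2
        exact integral_add h1 h2
      map_smul' := fun c f => by
        rw [RingHom.id_apply, ← MemLp.toLp_const_smul, MemLp.toLp_eq_toLp_iff]
        refine (hcongr _ _ (Lp.coeFn_smul c f)).trans ?_
        filter_upwards with ξ
        exact integral_smul c _ }
  refine ⟨L.mkContinuous K.toReal fun f => ?_, fun f hf => ?_⟩
  · change ‖(hmem f (Lp.memLp f)).toLp‖ ≤ _
    rw [Lp.norm_toLp, Lp.norm_def, ← ENNReal.toReal_mul]
    exact ENNReal.toReal_mono (ENNReal.mul_ne_top hK (Lp.memLp f).2.ne) (hle f (Lp.memLp f).1)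
  · refine (MemLp.coeFn_toLp (hmem _ (Lp.memLp (hf.toLp f)))).trans ?_
    exact hcongr _ _ hf.coeFn_toLp

/-! ### The kernel of the slice transform -/

namespace SphericalSlice

theorem isFiniteMeasure_surfaceMeasure {n : ℕ} (hn : 1 ≤ n) :
    IsFiniteMeasure (surfaceMeasure n) := ⟨by
  rw [surfaceMeasure, ← isometry_subtype_coe.euclideanHausdorffMeasure_image]
  have h : μHE[n] (sphere (0 : Ambient n) 1) < ⊤ :=
    euclideanHausdorffMeasure_unit_sphere_lt_top (by simp) hn
  rwa [Set.image_univ, Subtype.range_coe]⟩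

theorem one_sub_abs_le_norm_sub_pointA {n : ℕ} (a : ℝ) (η : Sn n) :
    1 - |a| ≤ ‖(η : Ambient n) - pointA n a‖ := by
  have h := norm_sub_norm_le (η : Ambient n) (pointA n a)
  simpa [norm_pointA] using h

/-- The normals of the slices that meet `t` have measure `O(diam t)`: if `η₀ ∈ t`, all of them
satisfy `|⟪ξ, η₀ - A⟫| ≤ diam t`, and `‖η₀ - A‖ ≥ 1 - |a| > 0`. -/
theorem exists_surfaceMeasure_slice_meets_le {n : ℕ} (hn : 1 ≤ n) {a : ℝ} (ha : |a| < 1) :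
    ∃ C : ℝ≥0∞, C ≠ ⊤ ∧ ∀ t : Set (Sn n), t.Nonempty → ∃ N, MeasurableSet N ∧
      (∀ ξ, (slice a ξ ∩ t).Nonempty → ξ ∈ N) ∧ surfaceMeasure n N ≤ C * ediam t := by
  obtain ⟨C, hC, h⟩ := exists_euclideanHausdorffMeasure_sphere_slab_le
    (V := Ambient n) (m := n) (by simp) hn
  have ha' : 0 < 1 - |a| := by linarith
  refine ⟨C * ENNReal.ofReal (1 - |a|)⁻¹, by finiteness, fun t ⟨η₀, hη₀⟩ => ?_⟩
  have ht : Bornology.IsBounded t := (isCompact_univ.isBounded).subset t.subset_univ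
  let u : Ambient n := (η₀ : Ambient n) - pointA n a
  have hu : 1 - |a| ≤ ‖u‖ := one_sub_abs_le_norm_sub_pointA a η₀
  have hu0 : 0 < ‖u‖ := ha'.trans_le hu
  refine ⟨{ξ | |inner ℝ u (ξ : Ambient n)| ≤ diam t}, ?_, ?_, ?_⟩
  · exact (isClosed_le (by fun_prop) continuous_const).measurableSet
  · rintro ξ ⟨η, hη, hηt⟩
    have h1 : inner ℝ (ξ : Ambient n) ((η : Ambient n) - pointA n a) = (0 : ℝ) := hη
    have h2 : inner ℝ u (ξ : Ambient n) =
        inner ℝ (ξ : Ambient n) ((η₀ : Ambient n) - (η : Ambient n)) := by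
      rw [real_inner_comm, ← sub_zero (inner ℝ (ξ : Ambient n) u), ← h1, ← inner_sub_right]
      simp [u]
    rw [Set.mem_ofPred_eq, h2]
    calc _ ≤ ‖(ξ : Ambient n)‖ * ‖(η₀ : Ambient n) - η‖ := abs_real_inner_le_norm _ _
      _ = dist η₀ η := by rw [norm_eq_of_mem_sphere, one_mul, Subtype.dist_eq, dist_eq_norm]
      _ ≤ diam t := dist_le_diam_of_mem ht hη₀ hηt
  · rw [surfaceMeasure, ← isometry_subtype_coe.euclideanHausdorffMeasure_image]
    calc _ ≤ μHE[n] {x : Ambient n | ‖x‖ = 1 ∧ |inner ℝ (‖u‖⁻¹ • u) x| ≤ (1 - |a|)⁻¹ * diam t} := by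
          refine measure_mono ?_
          rintro _ ⟨ξ, hξ, rfl⟩
          refine ⟨norm_eq_of_mem_sphere ξ, ?_⟩
          rw [inner_smul_left, abs_mul, conj_trivial, abs_inv, abs_norm]
          gcongr
          exact hξ
      _ ≤ C * ENNReal.ofReal ((1 - |a|)⁻¹ * diam t) :=
          h _ (norm_smul_inv_norm (𝕜 := ℝ) (norm_pos_iff.1 hu0)) _
            (mul_nonneg (inv_nonneg.2 ha'.le) diam_nonneg)
      _ = _ := by
          rw [ENNReal.ofReal_mul (inv_nonneg.2 ha'.le), diam,
            ENNReal.ofReal_toReal ht.ediam_ne_top, mul_assoc]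

/-- Averaging the slice measures over all normals gives a measure dominated by the surface
measure. -/
theorem exists_lintegral_sliceMeasure_le {n : ℕ} (hn : 2 ≤ n) {a : ℝ} (ha : |a| < 1) :
    ∃ C : ℝ≥0∞, C ≠ ⊤ ∧ ∀ B : Set (Sn n), MeasurableSet B →
      ∫⁻ ξ, sliceMeasure a ξ B ∂(surfaceMeasure n) ≤ C * surfaceMeasure n B := by
  obtain ⟨C, hC, h⟩ := exists_surfaceMeasure_slice_meets_le (n := n) (by omega) ha
  -- The factor between the two normalizations of the `d`-dimensional Hausdorff measure.
  let c : ℕ → ℝ≥0∞ := fun d =>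
    Measure.addHaarScalarFactor (volume : Measure (EuclideanSpace ℝ (Fin d))) μH[d]
  have hc0 : c n ≠ 0 := by
    simpa [c] using Measure.addHaarScalarFactor_volume_hausdorffMeasure_ne_zero n
  have hc : ∀ d, c d ≠ ⊤ := fun d => by simp [c]
  have hHE : ∀ d (B : Set (Sn n)), μHE[d] B = c d * μH[d] B := fun d B => by
    rw [Measure.euclideanHausdorffMeasure_def, Measure.smul_apply]
    rfl
  refine ⟨c (n - 1) * (C + 1) * (c n)⁻¹, by finiteness, fun B hB => ?_⟩
  -- Enlarging `C` to `C + 1` makes it nonzero.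
  have key := lintegral_hausdorffMeasure_inter_le (surfaceMeasure n) (slice a) (C := C + 1)
    (by simp) (by finiteness) (fun t ht => by
      obtain ⟨N, h1, h2, h3⟩ := h t ht
      exact ⟨N, h1, h2, h3.trans (by gcongr; exact le_self_add)⟩)
    (d := ((n - 1 : ℕ) : ℝ)) (by exact_mod_cast (by omega : 0 < n - 1)) B
  have hcast : ((n - 1 : ℕ) : ℝ) + 1 = (n : ℝ) := by exact_mod_cast (by omega : n - 1 + 1 = n)
  rw [hcast] at key
  calc ∫⁻ ξ, sliceMeasure a ξ B ∂(surfaceMeasure n)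
      = ∫⁻ ξ, c (n - 1) * μH[(n - 1 : ℕ)] (B ∩ slice a ξ) ∂(surfaceMeasure n) := by
        refine lintegral_congr fun ξ => ?_
        rw [sliceMeasure, Measure.restrict_apply hB, hHE]
    _ ≤ c (n - 1) * ((C + 1) * μH[n] B) := by
        rw [lintegral_const_mul' _ _ (hc _)]
        gcongr
    _ = _ := by
        rw [surfaceMeasure, hHE, mul_assoc _ (c n)⁻¹, ← mul_assoc (c n)⁻¹,
          ENNReal.inv_mul_cancel hc0 (hc n), one_mul, mul_assoc]

theorem isFiniteMeasure_sliceMeasure {n : ℕ} (hn : 2 ≤ n) {a : ℝ} (ha : |a| < 1) (ξ : Sn n) :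
    IsFiniteMeasure (sliceMeasure a ξ) := by
  obtain ⟨M, hM, h⟩ := exists_sliceMeasure_univ_le hn ha
  exact ⟨(h ξ).trans_lt hM.lt_top⟩

theorem integrable_sliceMeasure {G : Type*} [NormedAddCommGroup G] {n : ℕ} (hn : 2 ≤ n) {a : ℝ}
    (ha : |a| < 1) (ξ : Sn n) {f : Sn n → G} (hf : Continuous f) :
    Integrable f (sliceMeasure a ξ) := by
  have := isFiniteMeasure_sliceMeasure hn ha ξ
  exact hf.integrable_of_hasCompactSupport (.of_compactSpace f)

theorem continuous_sliceTransform {𝕜 : Type*} [RCLike 𝕜] {n : ℕ} (hn : 2 ≤ n) {a : ℝ}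
    (ha : |a| < 1) (f : C(Sn n, 𝕜)) : Continuous (sliceTransform a f) := by
  -- Tietze's theorem extends `f` continuously to the ambient space.
  obtain ⟨g, hg⟩ := f.exists_extension
    (isClosed_sphere (x := (0 : Ambient n)) (ε := 1)).isClosedEmbedding_subtypeVal
  have h := (contMDiff_integral_sliceMeasure hn ha (m := 0) (g := g)
    (contDiff_zero.2 g.continuous)).continuous
  convert h using 1
  ext ξ
  refine integral_congr_ae (.of_forall fun η => ?_)
  rw [← hg]
  rfl

/-- The mass of a closed set is a limit of integrals of continuous functions, which depend
continuously on the normal. -/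
theorem measurable_sliceMeasure {n : ℕ} (hn : 2 ≤ n) {a : ℝ} (ha : |a| < 1) :
    Measurable (sliceMeasure (n := n) a) := by
  have hfin := isFiniteMeasure_sliceMeasure hn ha
  have hclosed : ∀ B : Set (Sn n), IsClosed B → Measurable fun ξ => sliceMeasure a ξ B := by
    intro B hB
    have hδ : ∀ k : ℕ, (0 : ℝ) < 1 / ((k : ℝ) + 1) := fun k => by positivity
    refine measurable_of_tendsto_metrizable (f := fun (k : ℕ) (ξ : Sn n) =>
      ∫⁻ η, (thickenedIndicator (hδ k) B η : ℝ≥0∞) ∂(sliceMeasure a ξ)) (fun k => ?_)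
      (tendsto_pi_nhds.2 fun ξ => tendsto_lintegral_thickenedIndicator_of_isClosed
        (sliceMeasure a ξ) hB hδ tendsto_one_div_add_atTop_nhds_zero_nat)
    let f : C(Sn n, ℝ) := ⟨fun η => thickenedIndicator (hδ k) B η, by fun_prop⟩
    have hf := (continuous_sliceTransform hn ha f).measurable.ennreal_ofReal
    convert hf using 1
    ext ξ
    rw [sliceTransform, ofReal_integral_eq_lintegral_ofReal
      (integrable_sliceMeasure hn ha ξ f.continuous) (.of_forall fun η => NNReal.coe_nonneg _)]
    simp [f]
  exact .measure_of_isPiSystem (BorelSpace.measurable_eq.trans borel_eq_generateFrom_isClosed)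
    isPiSystem_isClosed hclosed (hclosed _ isClosed_univ)

/-- The slice measures as a kernel from normals to points of the sphere. -/
noncomputable def sliceKernel {n : ℕ} (hn : 2 ≤ n) {a : ℝ} (ha : |a| < 1) :
    Kernel (Sn n) (Sn n) := ⟨sliceMeasure a, measurable_sliceMeasure hn ha⟩

theorem isFiniteKernel_sliceKernel {n : ℕ} (hn : 2 ≤ n) {a : ℝ} (ha : |a| < 1) :
    IsFiniteKernel (sliceKernel hn ha) := by
  obtain ⟨M, hM, h⟩ := exists_sliceMeasure_univ_le hn ha
  exact ⟨M, hM.lt_top, h⟩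

theorem exists_comp_sliceKernel_le {n : ℕ} (hn : 2 ≤ n) {a : ℝ} (ha : |a| < 1) :
    ∃ C : ℝ≥0∞, C ≠ ⊤ ∧ sliceKernel hn ha ∘ₘ surfaceMeasure n ≤ C • surfaceMeasure n := by
  obtain ⟨C, hC, h⟩ := exists_lintegral_sliceMeasure_le hn ha
  refine ⟨C, hC, Measure.le_iff.2 fun B hB => ?_⟩
  rw [Measure.bind_apply hB (Kernel.aemeasurable _)]
  exact h B hB

theorem exists_continuousLinearMap_sliceTransform {𝕜 : Type*} [RCLike 𝕜] {n : ℕ} (hn : 2 ≤ n)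
    {a : ℝ} (ha : |a| < 1) :
    ∃ T : C(Sn n, 𝕜) →L[𝕜] C(Sn n, 𝕜), ∀ f ξ, T f ξ = sliceTransform a f ξ := by
  obtain ⟨M, hM, h⟩ := exists_sliceMeasure_univ_le hn ha
  have hfin := isFiniteMeasure_sliceMeasure hn ha
  let L : C(Sn n, 𝕜) →ₗ[𝕜] C(Sn n, 𝕜) :=
    { toFun := fun f => ⟨sliceTransform a f, continuous_sliceTransform hn ha f⟩
      map_add' := fun f g => by
        ext ξ
        exact integral_add (integrable_sliceMeasure hn ha ξ f.continuous)
          (integrable_sliceMeasure hn ha ξ g.continuous)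
      map_smul' := fun c f => by
        ext ξ
        exact integral_smul c _ }
  refine ⟨L.mkContinuous M.toReal fun f => ?_, fun f ξ => rfl⟩
  refine (ContinuousMap.norm_le _ (by positivity)).2 fun ξ => ?_
  calc ‖∫ η, f η ∂(sliceMeasure a ξ)‖ ≤ ‖f‖ * (sliceMeasure a ξ).real Set.univ :=
        norm_integral_le_of_norm_le_const (.of_forall fun η => f.norm_coe_le_norm η)
    _ ≤ M.toReal * ‖f‖ := by
        rw [mul_comm]
        gcongr
        exact ENNReal.toReal_mono hM (h ξ)

end SphericalSlice

end

theorem corollary3p1 {𝕜 : Type*} [RCLike 𝕜] (n : ℕ) (hn : 2 ≤ n) (a : ℝ)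
    (ha₁ : -1 < a) (ha₂ : a < 1) :
    -- the transform maps smooth functions to smooth functions
    (∀ f : SphericalSlice.Sn n → 𝕜, ContMDiff (𝓡 n) 𝓘(ℝ, 𝕜) ∞ f →
      ContMDiff (𝓡 n) 𝓘(ℝ, 𝕜) ∞ (SphericalSlice.sliceTransform a f)) ∧
    -- it is a bounded linear operator on continuous functions
    (∃ T : C(SphericalSlice.Sn n, 𝕜) →L[𝕜] C(SphericalSlice.Sn n, 𝕜),
      ∀ (f : C(SphericalSlice.Sn n, 𝕜)) (ξ : SphericalSlice.Sn n),
        Integrable f (SphericalSlice.sliceMeasure a ξ) ∧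
        T f ξ = SphericalSlice.sliceTransform a f ξ) ∧
    -- it is a bounded linear operator on every Lebesgue space, whatever the representative of
    -- the class: the slice integrals exist for almost every normal vector and give the image
    (∀ (p : ℝ≥0∞) [Fact (1 ≤ p)],
      ∃ T : Lp 𝕜 p (SphericalSlice.surfaceMeasure n) →L[𝕜]
          Lp 𝕜 p (SphericalSlice.surfaceMeasure n),
        ∀ (f : SphericalSlice.Sn n → 𝕜) (hf : MemLp f p (SphericalSlice.surfaceMeasure n)),
          (∀ᵐ ξ ∂(SphericalSlice.surfaceMeasure n),
            Integrable f (SphericalSlice.sliceMeasure a ξ)) ∧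
          (T (hf.toLp f) : SphericalSlice.Sn n → 𝕜)
            =ᵐ[SphericalSlice.surfaceMeasure n] SphericalSlice.sliceTransform a f) := by
  have ha : |a| < 1 := abs_lt.2 ⟨ha₁, ha₂⟩
  refine ⟨fun f hf => ?_, ?_, fun p hp => ?_⟩
  · obtain ⟨g, hg, hgf⟩ := SphericalSlice.exists_contDiff_extension hf
    convert SphericalSlice.contMDiff_integral_sliceMeasure hn ha hg using 2 with ξ
    exact integral_congr_ae (.of_forall fun η => (hgf η).symm)
  · obtain ⟨T, hT⟩ := SphericalSlice.exists_continuousLinearMap_sliceTransform (𝕜 := 𝕜) hn ha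
    exact ⟨T, fun f ξ =>
      ⟨SphericalSlice.integrable_sliceMeasure hn ha ξ f.continuous, hT f ξ⟩⟩
  · have := SphericalSlice.isFiniteMeasure_surfaceMeasure (n := n) (by omega)
    have := SphericalSlice.isFiniteKernel_sliceKernel hn ha
    obtain ⟨C, hC, h⟩ := SphericalSlice.exists_comp_sliceKernel_le hn ha
    obtain ⟨T, hT⟩ := exists_continuousLinearMap_Lp_integral_kernel (𝕜 := 𝕜) hC h p
    exact ⟨T, fun f hf => ⟨ae_integrable_kernel hC h hp.out hf, hT f hf⟩⟩
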